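/- Let $d\ge 1$, let $\alpha_1,\dots,\alpha_d$ be real numbers with $2\sum_{i=1}^d\alpha_i=1$, let $0<c<\min_i\alpha_i$ and let $M\ge 0$ be an integer. For each $i$ let $\tilde\alpha_i,\tilde\beta_i:\mathbb{Z}\to[c,\infty)$ be functions such that $\tilde\alpha_i(n)+\tilde\beta_i(n)\le 2\alpha_i$ and $\tilde\alpha_i(n)=\tilde\beta_i(-n)$ for all $n\in\mathbb{Z}$, and $\tilde\alpha_i(n)=\tilde\beta_i(n)$ whenever $|n|>M$ (in particular, the case $\tilde\alpha_i(n)=\tilde\beta_i(n)=\alpha_i$ for $|n|>M$ is included). Let $\mathbf{S}_t=(S_t^{(1)},\dots,S_t^{(d)})$, $t=0,1,2,\dots$, be the Markov chain on $\mathbb{Z}^d$ with $\mathbf{S}_0=\mathbf{0}$ and $\mathbf{S}_t=\mathbf{S}_{t-1}+\mathbf{e}_t$ for $t\ge1$, where, given $\mathbf{S}_0,\dots,\mathbf{S}_{t-1}$, the step $\mathbf{e}_t$ equals the unit vector $\mathbf{1}_i$ with probability $\tilde\alpha_i(S_{t-1}^{(i)})$ and $-\mathbf{1}_i$ with probability $\tilde\beta_i(S_{t-1}^{(i)})$,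 for $i=1,\dots,d$, and equals $\mathbf{0}$ with the complementary probability $1-\sum_{i=1}^d\big[\tilde\alpha_i(S_{t-1}^{(i)})+\tilde\beta_i(S_{t-1}^{(i)})\big]$. If $d\le2$, the walk is recurrent: almost surely $\mathbf{S}_t=\mathbf{0}$ for infinitely many $t$. If $d\ge3$, the walk is transient: almost surely $\mathbf{S}_t=\mathbf{0}$ for only finitely many $t$. -/

import Mathlib

open MeasureTheory Filter

/-- The parameters of the state-dependent nearest-neighbour walks on `ℤ^d`: the walk at `x` jumps
by `+1` in coordinate `i` with probability `up i (x i)`, and by `-1` in coordinate `i` with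
probability `down i (x i)`. The last condition asks only that the two probabilities agree off
`[-M, M]`; their common value may still depend on the position (`up i n = down i n = α i` is a
special case). -/
structure IsModelFive {d : ℕ} (α : Fin d → ℝ) (c : ℝ) (M : ℕ) (up down : Fin d → ℤ → ℝ) :
    Prop where
  two_mul_sum : 2 * ∑ i, α i = 1
  c_pos : 0 < c
  c_lt : ∀ i, c < α i
  le_up : ∀ i n, c ≤ up i n
  le_down : ∀ i n, c ≤ down i n
  add_le : ∀ i n, up i n + down i n ≤ 2 * α i
  reflect : ∀ i n, up i n = down i (-n)
  symmetric_off : ∀ i n, (M : ℤ) < |n| → up i n = down i n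

/-- The probability of moving from `x` to `y` in one step: `x + 1ᵢ` is chosen with probability
`up i (x i)`, `x - 1ᵢ` with probability `down i (x i)`, and the walk stays at `x` with the
complementary probability. -/
noncomputable def stepProb {d : ℕ} (up down : Fin d → ℤ → ℝ) (x y : Fin d → ℤ) : ℝ :=
  (∑ i, ((if y = x + Pi.single i 1 then up i (x i) else 0)
      + (if y = x - Pi.single i 1 then down i (x i) else 0)))
    + (if y = x then 1 - ∑ i, (up i (x i) + down i (x i)) else 0)

/-- `S` is a time-homogeneous Markov chain on `ℤ^d` started at the origin, with one-step
transition probabilities `p`: given the whole history up to time `t`, the next position is `y`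
with probability `p (S t) y`. -/
structure IsWalk {Ω : Type*} [MeasurableSpace Ω] (μ : Measure Ω) {d : ℕ}
    (p : (Fin d → ℤ) → (Fin d → ℤ) → ℝ) (S : ℕ → Ω → (Fin d → ℤ)) : Prop where
  measurable : ∀ t, Measurable (S t)
  start : ∀ᵐ ω ∂μ, S 0 ω = 0
  step : ∀ (t : ℕ) (x : ℕ → (Fin d → ℤ)),
    μ.real {ω | ∀ s ≤ t + 1, S s ω = x s}
      = μ.real {ω | ∀ s ≤ t, S s ω = x s} * p (x t) (x (t + 1))

/-- Recurrence: almost surely the walk is at the origin infinitely many times. -/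
def IsRecurrent {Ω : Type*} [MeasurableSpace Ω] (μ : Measure Ω) {d : ℕ}
    (S : ℕ → Ω → (Fin d → ℤ)) : Prop :=
  ∀ᵐ ω ∂μ, ∃ᶠ t in atTop, S t ω = 0

/-- Transience: almost surely the walk is at the origin only finitely many times. -/
def IsTransient {Ω : Type*} [MeasurableSpace Ω] (μ : Measure Ω) {d : ℕ}
    (S : ℕ → Ω → (Fin d → ℤ)) : Prop :=
  ∀ᵐ ω ∂μ, ∀ᶠ t in atTop, S t ω ≠ 0

/-! The reflection condition makes the walk reversible. In each coordinate `n ↦ w |n|` satisfies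
detailed balance, and the product of these weights reverses the walk on `ℤ^d`. Because `up` and
`down` agree off `[-M, M]`, the resulting conductances lie between two positive constants
(`conductance_bounded`). The Dirichlet form of the walk is therefore comparable to that of simple
random walk, and recurrence or transience depends only on the capacity of the origin in `ℤ^d`.

The link is the truncated Green function `G_n = ∑_{t<n} P^t δ_0`, whose energy is at most `G_n 0`.
If `f 0 ^ 2 ≤ B * E(f, f)` for all finitely supported `f`, then `G_n 0 ≤ B` (`greenFun_le`). If
instead `f 0 = 1` is compatible with arbitrarily small energy, `G_n 0` is unbounded
(`not_bounded_greenFun`). For `d ≥ 3` the inequality is a Hardy inequality obtained from a strictly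
superharmonic function of order `|x|^(-1/2)`. For `d ≤ 2` a logarithmic cutoff has small energy.

Finally `G_n 0` is the expected number of visits to the origin before time `n`. If it stays bounded,
Borel-Cantelli gives transience. If it is unbounded, a decomposition by the last visit gives
recurrence. -/

/-- The weights `w 0 = 1`, `w n * up n = w (n + 1) * down (n + 1)` that reverse a birth-death
chain on the half-line. -/
noncomputable def birthDeathWeight (up down : ℤ → ℝ) : ℕ → ℝ
  | 0 => 1
  | n + 1 => birthDeathWeight up down n * up n / down (n + 1)

/-- The product measure reversing the walk. -/
noncomputable def reversingWeight {d : ℕ} (up down : Fin d → ℤ → ℝ) (x : Fin d → ℤ) : ℝ :=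
  ∏ i, birthDeathWeight (up i) (down i) (x i).natAbs

/-- The generator `P - 1` of the walk. -/
noncomputable def generator {d : ℕ} (up down : Fin d → ℤ → ℝ) (f : (Fin d → ℤ) → ℝ)
    (x : Fin d → ℤ) : ℝ :=
  ∑ i, (up i (x i) * (f (x + Pi.single i 1) - f x) + down i (x i) * (f (x - Pi.single i 1) - f x))

/-- The transition operator of the walk. -/
noncomputable def transition {d : ℕ} (up down : Fin d → ℤ → ℝ) (f : (Fin d → ℤ) → ℝ)
    (x : Fin d → ℤ) : ℝ :=
  f x + generator up down f x

/-- The Dirichlet form with conductance `C i x` on the edge from `x` to `x + 1ᵢ`. -/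
noncomputable def dirichletForm {d : ℕ} (C : Fin d → (Fin d → ℤ) → ℝ)
    (f g : (Fin d → ℤ) → ℝ) : ℝ :=
  ∑ i, ∑' x, C i x * ((f (x + Pi.single i 1) - f x) * (g (x + Pi.single i 1) - g x))

/-- The conductances of the walk. -/
noncomputable def conductance {d : ℕ} (up down : Fin d → ℤ → ℝ) (i : Fin d)
    (x : Fin d → ℤ) : ℝ :=
  reversingWeight up down x * up i (x i)

/-! ### One-dimensional reversing weights: detailed balance and two-sided bounds. -/

section Weights

theorem birthDeathWeight_pos {up down : ℤ → ℝ} (hu : ∀ n, 0 < up n) (hd : ∀ n, 0 < down n)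
    (n : ℕ) : 0 < birthDeathWeight up down n := by
  induction n with
  | zero => simp [birthDeathWeight]
  | succ n ih => exact div_pos (mul_pos ih (hu _)) (hd _)

theorem birthDeathWeight_succ_mul {up down : ℤ → ℝ} (hd : ∀ n, 0 < down n) (n : ℕ) :
    birthDeathWeight up down (n + 1) * down (n + 1) = birthDeathWeight up down n * up n := by
  rw [birthDeathWeight, div_mul_cancel₀ _ (hd _).ne']

/-- For `n ≥ 0` this is the recursion of the weights. For `n < 0` the reflection `n ↦ -n` carries
the edge to one on the positive half-line and exchanges `up` with `down`. -/
theorem birthDeathWeight_natAbs_balance {up down : ℤ → ℝ} (hd : ∀ n, 0 < down n)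
    (hr : ∀ n, up n = down (-n)) (n : ℤ) :
    birthDeathWeight up down n.natAbs * up n
      = birthDeathWeight up down (n + 1).natAbs * down (n + 1) := by
  rcases lt_or_ge n 0 with h | h
  · obtain ⟨m, rfl⟩ : ∃ m : ℕ, n = -(m : ℤ) - 1 := ⟨(-n - 1).toNat, by omega⟩
    have h1 : (-(m : ℤ) - 1).natAbs = m + 1 := by omega
    have h2 : (-(m : ℤ) - 1 + 1).natAbs = m := by omega
    rw [h1, h2, hr, show -(-(m : ℤ) - 1) = m + 1 by ring, birthDeathWeight_succ_mul hd, hr m]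
    congr 2; ring
  · obtain ⟨m, rfl⟩ := Int.eq_ofNat_of_zero_le h
    have h2 : ((m : ℤ) + 1).natAbs = m + 1 := by omega
    rw [h2, birthDeathWeight_succ_mul hd]; simp

theorem birthDeathWeight_bounded {up down : ℤ → ℝ} {c : ℝ} (hc : 0 < c) (M : ℕ)
    (hu : ∀ n, c ≤ up n) (hd : ∀ n, c ≤ down n) (hu1 : ∀ n, up n ≤ 1)
    (hs : ∀ n : ℤ, (M : ℤ) < |n| → up n = down n) :
    ∃ a b : ℝ, 0 < a ∧ ∀ n, a ≤ birthDeathWeight up down n ∧ birthDeathWeight up down n ≤ b := by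
  have hd0 : ∀ n, 0 < down n := fun n => hc.trans_le (hd n)
  have hpos := birthDeathWeight_pos (fun n => hc.trans_le (hu n)) hd0
  set w := birthDeathWeight up down with hw
  have hfin : ∀ N : ℕ, ∃ a b : ℝ, 0 < a ∧ ∀ n ≤ N, a ≤ w n ∧ w n ≤ b := by
    intro N
    induction N with
    | zero => exact ⟨w 0, w 0, hpos 0, fun n hn => by simp [Nat.le_zero.1 hn]⟩
    | succ N ih =>
      obtain ⟨a, b, ha, hab⟩ := ih
      refine ⟨min a (w (N + 1)), max b (w (N + 1)), lt_min ha (hpos _), fun n hn => ?_⟩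
      rcases Nat.lt_or_ge N n with h | h
      · obtain rfl : n = N + 1 := by omega
        exact ⟨min_le_right _ _, le_max_right _ _⟩
      · exact ⟨(min_le_left _ _).trans (hab n h).1, (hab n h).2.trans (le_max_left _ _)⟩
  -- Where `up = down`, detailed balance says that `w n * up n` is constant. As `c ≤ up ≤ 1`, this
  -- confines `w` to `[K, K / c]`; the finitely many earlier values are covered by `hfin`.
  have hconst : ∀ k : ℕ, w (M + 1 + k) * up ((M + 1 + k : ℕ) : ℤ) = w (M + 1) * up ((M + 1 : ℕ) : ℤ) := by
    intro k
    induction k with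
    | zero => rfl
    | succ k ih =>
      rw [← ih, hs _ (by rw [abs_of_nonneg (by positivity)]; push_cast; omega)]
      have := birthDeathWeight_succ_mul (up := up) hd0 (M + 1 + k)
      rw [← this]; norm_cast
  obtain ⟨a, b, ha, hab⟩ := hfin (M + 1)
  set K := w (M + 1) * up ((M + 1 : ℕ) : ℤ)
  have hK : 0 < K := mul_pos (hpos _) (hc.trans_le (hu _))
  refine ⟨min a K, max b (K / c), lt_min ha hK, fun n => ?_⟩
  rcases Nat.lt_or_ge (M + 1) n with h | h
  · obtain ⟨k, rfl⟩ := Nat.exists_eq_add_of_le h.le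
    have h1 := hconst k
    refine ⟨(min_le_right _ _).trans ?_, le_trans ?_ (le_max_right _ _)⟩
    · rw [← h1]
      exact mul_le_of_le_one_right (hpos _).le (hu1 _)
    · rw [le_div_iff₀ hc, ← h1]
      exact mul_le_mul_of_nonneg_left (hu _) (hpos _).le
  · exact ⟨(min_le_left _ _).trans (hab n h).1, (hab n h).2.trans (le_max_left _ _)⟩

theorem finset_prod_le_prod_of_nonneg {ι : Type*} (s : Finset ι) {f g : ι → ℝ}
    (h0 : ∀ i, 0 ≤ f i) (h : ∀ i, f i ≤ g i) : ∏ i ∈ s, f i ≤ ∏ i ∈ s, g i :=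
  Finset.prod_le_prod (fun i _ => h0 i) fun i _ => h i

end Weights

/-! ### Reversibility of the walk and uniform ellipticity of its conductances. -/

namespace IsModelFive

variable {d : ℕ} {α : Fin d → ℝ} {c : ℝ} {M : ℕ} {up down : Fin d → ℤ → ℝ}

theorem up_pos (h : IsModelFive α c M up down) (i : Fin d) (n : ℤ) : 0 < up i n :=
  h.c_pos.trans_le (h.le_up i n)

theorem down_pos (h : IsModelFive α c M up down) (i : Fin d) (n : ℤ) : 0 < down i n :=
  h.c_pos.trans_le (h.le_down i n)

theorem sum_add_le_one (h : IsModelFive α c M up down) (x : Fin d → ℤ) :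
    ∑ i, (up i (x i) + down i (x i)) ≤ 1 := by
  rw [← h.two_mul_sum, Finset.mul_sum]
  exact Finset.sum_le_sum fun i _ => h.add_le i _

theorem up_le_one (h : IsModelFive α c M up down) (i : Fin d) (n : ℤ) : up i n ≤ 1 := by
  have h1 := h.sum_add_le_one (fun _ => n)
  have h2 : up i n + down i n ≤ ∑ j, (up j n + down j n) :=
    Finset.single_le_sum (f := fun j => up j n + down j n)
      (fun j _ => (add_pos (h.up_pos j n) (h.down_pos j n)).le) (Finset.mem_univ i)
  linarith [h.down_pos i n]

theorem reversingWeight_pos (h : IsModelFive α c M up down) (x : Fin d → ℤ) :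
    0 < reversingWeight up down x :=
  Finset.prod_pos fun i _ => birthDeathWeight_pos (h.up_pos i) (h.down_pos i) _

/-- Only the `i`-th factor of the product weight changes along an edge in direction `i`, so the
one-dimensional balance suffices. -/
theorem balance (h : IsModelFive α c M up down) (i : Fin d) (x : Fin d → ℤ) :
    reversingWeight up down (x + Pi.single i 1) * down i (x i + 1)
      = conductance up down i x := by
  have key := birthDeathWeight_natAbs_balance (h.down_pos i) (h.reflect i) (x i)
  have hi : (x + Pi.single i 1 : Fin d → ℤ) i = x i + 1 := by simp
  have hprod : ∏ j ∈ Finset.univ.erase i,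
        birthDeathWeight (up j) (down j) ((x + Pi.single i 1 : Fin d → ℤ) j).natAbs
      = ∏ j ∈ Finset.univ.erase i, birthDeathWeight (up j) (down j) (x j).natAbs := by
    refine Finset.prod_congr rfl fun j hj => ?_
    rw [Pi.add_apply, Pi.single_eq_of_ne (Finset.ne_of_mem_erase hj), add_zero]
  rw [conductance, reversingWeight, reversingWeight,
    ← Finset.mul_prod_erase _ _ (Finset.mem_univ i), ← Finset.mul_prod_erase (a := i) _
      (fun j => birthDeathWeight (up j) (down j) (x j).natAbs) (Finset.mem_univ i), hi, hprod]
  linear_combination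
    -(∏ j ∈ Finset.univ.erase i, birthDeathWeight (up j) (down j) (x j).natAbs) * key

/-- The agreement of `up` and `down` off `[-M, M]` enters the argument only here. -/
theorem conductance_bounded (h : IsModelFive α c M up down) :
    ∃ a b : ℝ, 0 < a ∧ ∀ i x, a ≤ conductance up down i x ∧ conductance up down i x ≤ b := by
  choose a b ha hab using fun i => birthDeathWeight_bounded h.c_pos M (h.le_up i) (h.le_down i)
    (h.up_le_one i) (h.symmetric_off i)
  refine ⟨(∏ i, a i) * c, ∏ i, b i, mul_pos (Finset.prod_pos fun i _ => ha i) h.c_pos,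
    fun i x => ⟨?_, ?_⟩⟩
  · exact mul_le_mul (finset_prod_le_prod_of_nonneg _ (fun i => (ha i).le) fun i => (hab i _).1)
      (h.le_up i _) h.c_pos.le (h.reversingWeight_pos x).le
  · refine (mul_le_of_le_one_right (h.reversingWeight_pos x).le (h.up_le_one i _)).trans ?_
    exact finset_prod_le_prod_of_nonneg _
      (fun i => (birthDeathWeight_pos (h.up_pos i) (h.down_pos i) _).le) fun i => (hab i _).2

end IsModelFive

/-! ### Dirichlet forms of finitely supported functions. -/

section FiniteSupport

theorem hasFiniteSupport_comp_equiv {X : Type*} {f : X → ℝ} (hf : f.support.Finite) (e : X ≃ X) :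
    (fun x => f (e x)).support.Finite :=
  hf.preimage e.injective.injOn

theorem summable_of_support {X : Type*} {f g : X → ℝ} (hf : f.support.Finite)
    (h : ∀ x, f x = 0 → g x = 0) : Summable g :=
  summable_of_hasFiniteSupport (hf.subset fun x hx h0 => hx (h x h0))

variable {d : ℕ} {up down : Fin d → ℤ → ℝ} {f g : (Fin d → ℤ) → ℝ}

theorem finite_support_add_single (hf : f.support.Finite) (v : Fin d → ℤ) :
    (fun x => f (x + v)).support.Finite :=
  hasFiniteSupport_comp_equiv hf (Equiv.addRight v)

theorem finite_support_diff (hf : f.support.Finite) (v : Fin d → ℤ) :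
    (fun x => f (x + v) - f x).support.Finite :=
  ((finite_support_add_single hf v).union hf).subset (Function.support_sub _ _)

theorem finite_support_transition (hf : f.support.Finite) :
    (transition up down f).support.Finite := by
  have : (transition up down f).support ⊆ f.support ∪ ⋃ i : Fin d,
      ((fun x => f (x + Pi.single i 1)).support ∪ (fun x => f (x + -Pi.single i 1)).support) := by
    intro x hx
    by_contra hn
    simp only [Set.mem_union, Set.mem_iUnion, Function.mem_support, not_or, not_exists, not_not]
      at hn
    refine hx ?_
    simp only [transition, generator, hn.1, sub_eq_add_neg x, (hn.2 _).1, (hn.2 _).2]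
    simp
  exact (hf.union (Set.finite_iUnion fun i => (finite_support_add_single hf _).union
    (finite_support_add_single hf _))).subset this

theorem summable_dirichletForm (C : Fin d → (Fin d → ℤ) → ℝ) (hf : f.support.Finite) (i : Fin d) :
    Summable fun x => C i x * ((f (x + Pi.single i 1) - f x) * (g (x + Pi.single i 1) - g x)) :=
  summable_of_support (finite_support_diff hf (Pi.single i 1)) fun x hx => by
    rw [hx]; ring

theorem dirichletForm_comm (C : Fin d → (Fin d → ℤ) → ℝ) :
    dirichletForm C f g = dirichletForm C g f := by
  simp only [dirichletForm]
  refine Finset.sum_congr rfl fun i _ => tsum_congr fun x => by ring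

/-- Weighted arithmetic-geometric mean form of the Cauchy-Schwarz inequality. -/
theorem two_mul_dirichletForm_le {C : Fin d → (Fin d → ℤ) → ℝ} (hC : ∀ i x, 0 ≤ C i x)
    (hf : f.support.Finite) (hg : g.support.Finite) {r : ℝ} (hr : 0 < r) :
    2 * dirichletForm C f g ≤ r * dirichletForm C f f + r⁻¹ * dirichletForm C g g := by
  simp only [dirichletForm, Finset.mul_sum, ← Finset.sum_add_distrib]
  refine Finset.sum_le_sum fun i _ => ?_
  have h1 := summable_dirichletForm (g := g) C hf i
  have h2 := summable_dirichletForm (g := f) C hf i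
  have h3 := summable_dirichletForm (g := g) C hg i
  rw [← tsum_mul_left, ← tsum_mul_left, ← tsum_mul_left,
    ← (h2.mul_left r).tsum_add (h3.mul_left r⁻¹)]
  refine (h1.mul_left 2).tsum_le_tsum (fun x => ?_) ((h2.mul_left r).add (h3.mul_left r⁻¹))
  set p := f (x + Pi.single i 1) - f x
  set q := g (x + Pi.single i 1) - g x
  have key : 0 ≤ r⁻¹ * (r * p - q) ^ 2 := by positivity
  have : r⁻¹ * (r * p - q) ^ 2 = r * p ^ 2 - 2 * (p * q) + r⁻¹ * q ^ 2 := by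
    field_simp
    ring
  rw [this] at key
  linarith [mul_nonneg (hC i x) key]

theorem dirichletForm_mono {C D : Fin d → (Fin d → ℤ) → ℝ} (h : ∀ i x, C i x ≤ D i x)
    (hf : f.support.Finite) : dirichletForm C f f ≤ dirichletForm D f f :=
  Finset.sum_le_sum fun i _ => (summable_dirichletForm C hf i).tsum_le_tsum
    (fun x => mul_le_mul_of_nonneg_right (h i x) (mul_self_nonneg _))
    (summable_dirichletForm D hf i)

theorem dirichletForm_const_mul (r : ℝ) (C : Fin d → (Fin d → ℤ) → ℝ) :
    dirichletForm (fun i x => r * C i x) f g = r * dirichletForm C f g := by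
  simp only [dirichletForm, Finset.mul_sum, ← tsum_mul_left, mul_assoc]

/-- Green's identity. -/
theorem tsum_mul_generator {π : (Fin d → ℤ) → ℝ}
    (hb : ∀ i x, π (x + Pi.single i 1) * down i (x i + 1) = π x * up i (x i))
    (hf : f.support.Finite) :
    ∑' x, π x * (f x * generator up down g x)
      = -dirichletForm (fun i x => π x * up i (x i)) f g := by
  have hA : ∀ i, Summable fun x =>
      π x * (f x * (up i (x i) * (g (x + Pi.single i 1) - g x))) := fun i =>
    summable_of_support hf fun x hx => by rw [hx]; ring
  have hB : ∀ i, Summable fun x =>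
      π x * (f x * (down i (x i) * (g (x - Pi.single i 1) - g x))) := fun i =>
    summable_of_support hf fun x hx => by rw [hx]; ring
  have hsplit : ∀ x, π x * (f x * generator up down g x) = ∑ i,
      (π x * (f x * (up i (x i) * (g (x + Pi.single i 1) - g x)))
        + π x * (f x * (down i (x i) * (g (x - Pi.single i 1) - g x)))) := by
    intro x
    simp only [generator, Finset.mul_sum]
    exact Finset.sum_congr rfl fun i _ => by ring
  simp only [hsplit]
  rw [Summable.tsum_finsetSum fun i _ => (hA i).add (hB i), dirichletForm,
    ← Finset.sum_neg_distrib]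
  refine Finset.sum_congr rfl fun i _ => ?_
  -- Translating by `1ᵢ` places the downward jump from `x + 1ᵢ` on the same edge as the upward jump
  -- from `x`; detailed balance `hb` then gives both the same conductance.
  have hshift : ∑' x, π x * (f x * (down i (x i) * (g (x - Pi.single i 1) - g x)))
      = ∑' x, π (x + Pi.single i 1) * (f (x + Pi.single i 1) *
          (down i (x i + 1) * (g x - g (x + Pi.single i 1)))) := by
    rw [← (Equiv.addRight (Pi.single i (1 : ℤ))).tsum_eq]
    exact tsum_congr fun x => by simp
  have hB' : Summable fun x => π (x + Pi.single i 1) * (f (x + Pi.single i 1) *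
          (down i (x i + 1) * (g x - g (x + Pi.single i 1)))) :=
    summable_of_support (finite_support_add_single hf (Pi.single i 1)) fun x hx => by
      rw [hx]; ring
  rw [(hA i).tsum_add (hB i), hshift, ← (hA i).tsum_add hB', ← tsum_neg]
  refine tsum_congr fun x => ?_
  linear_combination (f (x + Pi.single i 1) * (g x - g (x + Pi.single i 1))) * hb i x

end FiniteSupport

/-! ### Green function estimates from the Dirichlet form. -/

/-- The function `x ↦ P_x(S_n = 0)`. -/
noncomputable def hitProb {d : ℕ} (up down : Fin d → ℤ → ℝ) (n : ℕ) : (Fin d → ℤ) → ℝ :=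
  (transition up down)^[n] (Pi.single 0 1)

/-- The Green function `x ↦ E_x #{t < n | S_t = 0}` of the walk stopped before time `n`. -/
noncomputable def greenFun {d : ℕ} (up down : Fin d → ℤ → ℝ) (n : ℕ) (x : Fin d → ℤ) : ℝ :=
  ∑ t ∈ Finset.range n, hitProb up down t x

section Green

variable {d : ℕ} {up down : Fin d → ℤ → ℝ} {f g : (Fin d → ℤ) → ℝ}

theorem hitProb_succ (n : ℕ) :
    hitProb up down (n + 1) = transition up down (hitProb up down n) :=
  Function.iterate_succ_apply' _ _ _

theorem finite_support_hitProb (n : ℕ) : (hitProb up down n).support.Finite := by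
  induction n with
  | zero => exact (Set.finite_singleton 0).subset (by
      simp [hitProb])
  | succ n ih => rw [hitProb_succ]; exact finite_support_transition ih

theorem finite_support_greenFun (n : ℕ) : (greenFun up down n).support.Finite := by
  refine (Set.finite_iUnion fun t : Fin n => finite_support_hitProb (up := up) (down := down)
    (t : ℕ)).subset fun x hx => ?_
  by_contra hn
  simp only [Set.mem_iUnion, Function.mem_support, not_exists, not_not] at hn
  exact hx (Finset.sum_eq_zero fun t ht => hn ⟨t, Finset.mem_range.1 ht⟩)

theorem generator_finset_sum {ι : Type*} (s : Finset ι) (F : ι → (Fin d → ℤ) → ℝ)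
    (x : Fin d → ℤ) : generator up down (fun y => ∑ t ∈ s, F t y) x
      = ∑ t ∈ s, generator up down (F t) x := by
  simp only [generator, ← Finset.sum_sub_distrib, Finset.mul_sum, ← Finset.sum_add_distrib]
  exact Finset.sum_comm

/-- `(P - 1) P^t = P^(t+1) - P^t`, so the sum telescopes. -/
theorem generator_greenFun (n : ℕ) (x : Fin d → ℤ) :
    generator up down (greenFun up down n) x = hitProb up down n x - hitProb up down 0 x := by
  rw [show greenFun up down n = fun y => ∑ t ∈ Finset.range n, hitProb up down t y from rfl,
    generator_finset_sum, ← Finset.sum_range_sub (fun t => hitProb up down t x)]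
  refine Finset.sum_congr rfl fun t _ => ?_
  rw [hitProb_succ, transition]; ring

namespace IsModelFive

variable {α : Fin d → ℝ} {c : ℝ} {M : ℕ}

theorem transition_nonneg (h : IsModelFive α c M up down) (hf : ∀ x, 0 ≤ f x) (x : Fin d → ℤ) :
    0 ≤ transition up down f x := by
  have h1 : transition up down f x = (1 - ∑ i, (up i (x i) + down i (x i))) * f x
      + ∑ i, (up i (x i) * f (x + Pi.single i 1) + down i (x i) * f (x - Pi.single i 1)) := by
    rw [transition, generator, sub_mul, one_mul, Finset.sum_mul, sub_add, ← Finset.sum_sub_distrib,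
      sub_eq_add_neg, ← Finset.sum_neg_distrib]
    congr 1
    exact Finset.sum_congr rfl fun i _ => by ring
  rw [h1]
  exact add_nonneg (mul_nonneg (sub_nonneg.2 (h.sum_add_le_one x)) (hf x))
    (Finset.sum_nonneg fun i _ => add_nonneg (mul_nonneg (h.up_pos i _).le (hf _))
      (mul_nonneg (h.down_pos i _).le (hf _)))

theorem hitProb_nonneg (h : IsModelFive α c M up down) (n : ℕ) (x : Fin d → ℤ) :
    0 ≤ hitProb up down n x := by
  induction n generalizing x with
  | zero => rw [hitProb, Function.iterate_zero, id, Pi.single_apply]; split_ifs <;> simp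
  | succ n ih => rw [hitProb_succ]; exact h.transition_nonneg ih x

theorem greenFun_nonneg (h : IsModelFive α c M up down) (n : ℕ) (x : Fin d → ℤ) :
    0 ≤ greenFun up down n x :=
  Finset.sum_nonneg fun t _ => h.hitProb_nonneg t x

theorem conductance_nonneg (h : IsModelFive α c M up down) (i : Fin d) (x : Fin d → ℤ) :
    0 ≤ conductance up down i x :=
  mul_nonneg (h.reversingWeight_pos x).le (h.up_pos i _).le

theorem tsum_mul_generator (h : IsModelFive α c M up down) (hf : f.support.Finite) :
    ∑' x, reversingWeight up down x * (f x * generator up down g x)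
      = -dirichletForm (conductance up down) f g :=
  _root_.tsum_mul_generator h.balance hf

/-- Self-adjointness of `P` in the weighted `ℓ²` space is the symmetry of the Dirichlet form, read
through Green's identity. -/
theorem tsum_mul_transition_comm (h : IsModelFive α c M up down) (hf : f.support.Finite)
    (hg : g.support.Finite) :
    ∑' x, reversingWeight up down x * (f x * transition up down g x)
      = ∑' x, reversingWeight up down x * (transition up down f x * g x) := by
  have e1 := h.tsum_mul_generator (g := g) hf
  have e2 := h.tsum_mul_generator (g := f) hg
  rw [dirichletForm_comm, ← e1] at e2
  have s0 : Summable fun x => reversingWeight up down x * (f x * g x) :=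
    summable_of_support hf fun x hx => by rw [hx]; ring
  have s1 : Summable fun x => reversingWeight up down x * (f x * generator up down g x) :=
    summable_of_support hf fun x hx => by rw [hx]; ring
  have s2 : Summable fun x => reversingWeight up down x * (g x * generator up down f x) :=
    summable_of_support hg fun x hx => by rw [hx]; ring
  calc _ = ∑' x, reversingWeight up down x * (f x * g x)
        + ∑' x, reversingWeight up down x * (f x * generator up down g x) := by
          rw [← s0.tsum_add s1]; exact tsum_congr fun x => by rw [transition]; ring
    _ = _ := by
          rw [← e2, ← s0.tsum_add s2]; exact tsum_congr fun x => by rw [transition]; ring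

theorem tsum_iterate_comm (h : IsModelFive α c M up down) (n m : ℕ) :
    ∑' x, reversingWeight up down x * (hitProb up down n x * hitProb up down m x)
      = ∑' x, reversingWeight up down x * (hitProb up down 0 x * hitProb up down (n + m) x) := by
  induction n generalizing m with
  | zero => rw [zero_add]
  | succ n ih =>
    rw [hitProb_succ, ← h.tsum_mul_transition_comm (finite_support_hitProb n)
      (finite_support_hitProb m), ← hitProb_succ, ih, Nat.add_right_comm, Nat.add_assoc]

theorem tsum_mul_hitProb_zero (f : (Fin d → ℤ) → ℝ) :
    ∑' x, reversingWeight up down x * (f x * hitProb up down 0 x) = f 0 := by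
  rw [tsum_eq_single 0]
  · simp [reversingWeight, birthDeathWeight, hitProb]
  · intro x hx
    simp [hitProb, Pi.single_eq_of_ne hx]

/-- By self-adjointness the weighted norm `‖P^n δ_0‖²` equals `⟨δ_0, P^(2n) δ_0⟩`, the return
probability at time `2n` since the origin has weight one. A single term is at most the whole sum. -/
theorem reversingWeight_mul_hitProb_sq_le (h : IsModelFive α c M up down) (n : ℕ)
    (x : Fin d → ℤ) :
    reversingWeight up down x * hitProb up down n x ^ 2 ≤ hitProb up down (n + n) 0 := by
  have e : ∑' x, reversingWeight up down x * (hitProb up down n x * hitProb up down n x)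
      = hitProb up down (n + n) 0 := by
    rw [h.tsum_iterate_comm, ← tsum_mul_hitProb_zero (up := up) (down := down) (hitProb up down (n + n))]
    exact tsum_congr fun x => by ring
  have s : Summable fun x => reversingWeight up down x *
      (hitProb up down n x * hitProb up down n x) :=
    summable_of_support (finite_support_hitProb (up := up) (down := down) n)
      fun x hx => by rw [hx]; ring
  rw [← e, pow_two]
  exact s.le_tsum x fun y _ => mul_nonneg (h.reversingWeight_pos y).le (mul_self_nonneg _)

theorem dirichletForm_greenFun (h : IsModelFive α c M up down) (n : ℕ) (hf : f.support.Finite) :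
    dirichletForm (conductance up down) f (greenFun up down n)
      = f 0 - ∑' x, reversingWeight up down x * (f x * hitProb up down n x) := by
  have e := h.tsum_mul_generator (g := greenFun up down n) hf
  rw [← tsum_mul_hitProb_zero (up := up) (down := down) f, ← neg_eq_iff_eq_neg.2 e,
    neg_eq_iff_eq_neg, neg_sub, ← Summable.tsum_sub]
  · exact tsum_congr fun x => by rw [generator_greenFun]; ring
  · exact summable_of_support hf fun x hx => by rw [hx]; ring
  · exact summable_of_support hf fun x hx => by rw [hx]; ring

theorem dirichletForm_greenFun_self_le (h : IsModelFive α c M up down) (n : ℕ) :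
    dirichletForm (conductance up down) (greenFun up down n) (greenFun up down n)
      ≤ greenFun up down n 0 := by
  rw [h.dirichletForm_greenFun n (finite_support_greenFun n), sub_le_self_iff]
  exact tsum_nonneg fun x => mul_nonneg (h.reversingWeight_pos x).le
    (mul_nonneg (h.greenFun_nonneg n x) (h.hitProb_nonneg n x))

/-- If point values are controlled by the Dirichlet form, the Green function is bounded. -/
theorem greenFun_le (h : IsModelFive α c M up down) {B : ℝ}
    (hB : ∀ f : (Fin d → ℤ) → ℝ, f.support.Finite →
      f 0 ^ 2 ≤ B * dirichletForm (conductance up down) f f) (hB0 : 0 ≤ B) (n : ℕ) :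
    greenFun up down n 0 ≤ B := by
  have h1 := (hB _ (finite_support_greenFun n)).trans
    (mul_le_mul_of_nonneg_left (h.dirichletForm_greenFun_self_le n) hB0)
  by_contra! hlt
  nlinarith

/-- If the origin has capacity zero, the Green function is unbounded. -/
theorem not_bounded_greenFun (h : IsModelFive α c M up down)
    (hcap : ∀ ε > 0, ∃ f : (Fin d → ℤ) → ℝ, f.support.Finite ∧ f 0 = 1 ∧
      dirichletForm (conductance up down) f f < ε) (B : ℝ) :
    ¬ ∀ n, greenFun up down n 0 ≤ B := by
  intro hB
  have hB0 : 0 ≤ B := (h.greenFun_nonneg 0 0).trans (hB 0)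
  obtain ⟨f, hf, hf0, hfe⟩ := hcap (B + 1)⁻¹ (by positivity)
  have hsum : Summable fun n => hitProb up down n 0 :=
    summable_of_sum_range_le (fun n => h.hitProb_nonneg n 0) hB
  -- A bounded Green function makes the return probabilities summable, hence null, and the previous
  -- estimate carries this to every site.
  have hx : ∀ x, Tendsto (fun n => hitProb up down n x) atTop (nhds 0) := by
    intro x
    have h1 : Tendsto (fun n => (reversingWeight up down x)⁻¹ * hitProb up down (n + n) 0) atTop
        (nhds 0) := by
      have := (hsum.tendsto_atTop_zero.comp (tendsto_atTop_mono (fun n => Nat.le_add_left n n)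
        tendsto_id)).const_mul (reversingWeight up down x)⁻¹
      simpa using this
    have h2 : Tendsto (fun n => hitProb up down n x ^ 2) atTop (nhds 0) := by
      refine squeeze_zero (fun n => sq_nonneg _) (fun n => ?_) h1
      rw [← div_eq_inv_mul, le_div_iff₀ (h.reversingWeight_pos x), mul_comm]
      exact h.reversingWeight_mul_hitProb_sq_le n x
    have h3 := h2.sqrt
    simpa [Real.sqrt_sq (h.hitProb_nonneg _ x)] using h3
  have hlim : Tendsto (fun n => ∑' x, reversingWeight up down x * (f x * hitProb up down n x))
      atTop (nhds 0) := by
    have heq : ∀ n, ∑' x, reversingWeight up down x * (f x * hitProb up down n x)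
        = ∑ x ∈ hf.toFinset, reversingWeight up down x * (f x * hitProb up down n x) := fun n =>
      tsum_eq_sum fun x hx => by
        have : f x = 0 := by simpa using hx
        rw [this]; ring
    simp only [heq]
    have := tendsto_finsetSum hf.toFinset fun x _ =>
      ((hx x).const_mul (f x)).const_mul (reversingWeight up down x)
    simpa using this
  have hev := hlim.eventually (gt_mem_nhds (show (0 : ℝ) < (B + 1)⁻¹ / 2 by positivity))
  obtain ⟨n, hn⟩ := hev.exists
  -- With `r = (B + 1)⁻¹` the right side is less than `B / (B + 1) + 1 = 2 - (B + 1)⁻¹`, whereas the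
  -- left side is `2 * E(G_n, f) > 2 - (B + 1)⁻¹` by the choice of `n`.
  have h1 := two_mul_dirichletForm_le h.conductance_nonneg
    (finite_support_greenFun (up := up) (down := down) n) hf
    (show (0 : ℝ) < (B + 1)⁻¹ by positivity)
  rw [dirichletForm_comm, h.dirichletForm_greenFun n hf, hf0, inv_inv] at h1
  have h2 := mul_le_mul_of_nonneg_left ((h.dirichletForm_greenFun_self_le n).trans (hB n))
    (show (0 : ℝ) ≤ (B + 1)⁻¹ by positivity)
  have h3 := mul_lt_mul_of_pos_left hfe (show 0 < B + 1 by positivity)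
  have h4 : (B + 1) * (B + 1)⁻¹ = 1 := mul_inv_cancel₀ (by positivity)
  linarith

end IsModelFive

end Green

/-! ### A Hardy inequality at the origin in dimension at least three. -/

section GroundState

variable {d : ℕ} {f : (Fin d → ℤ) → ℝ}

/-- The difference of the two sides is the square `(a * q - b * p) ^ 2 / (p * q)`. -/
theorem sq_mul_one_sub_div_add_le {p q : ℝ} (hp : 0 < p) (hq : 0 < q) (a b : ℝ) :
    a ^ 2 * (1 - q / p) + b ^ 2 * (1 - p / q) ≤ 1 * ((b - a) * (b - a)) := by
  have key : 0 ≤ (a * q - b * p) ^ 2 / (p * q) := by positivity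
  have e : (a * q - b * p) ^ 2 / (p * q) = a ^ 2 * (q / p) + b ^ 2 * (p / q) - 2 * (a * b) := by
    field_simp
    ring
  rw [e] at key
  linarith

/-- The ground state inequality for the lattice Laplacian: a positive function `u` yields a lower
bound on the Dirichlet form with potential `-Δu / u`. -/
theorem tsum_sq_mul_le_dirichletForm {u : (Fin d → ℤ) → ℝ} (hu : ∀ x, 0 < u x)
    (hf : f.support.Finite) :
    ∑' x, f x ^ 2 * ∑ i, ((1 - u (x + Pi.single i 1) / u x) + (1 - u (x - Pi.single i 1) / u x))
      ≤ dirichletForm (fun _ _ => 1) f f := by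
  have hA : ∀ i, Summable fun x => f x ^ 2 * (1 - u (x + Pi.single i 1) / u x) := fun i =>
    summable_of_support hf fun x hx => by rw [hx]; ring
  have hB : ∀ i, Summable fun x => f x ^ 2 * (1 - u (x - Pi.single i 1) / u x) := fun i =>
    summable_of_support hf fun x hx => by rw [hx]; ring
  have hB' : ∀ i, Summable fun x =>
      f (x + Pi.single i 1) ^ 2 * (1 - u x / u (x + Pi.single i 1)) := fun i =>
    summable_of_support (finite_support_add_single hf (Pi.single i 1)) fun x hx => by
      rw [hx]; ring
  have hshift : ∀ i, ∑' x, f x ^ 2 * (1 - u (x - Pi.single i 1) / u x)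
      = ∑' x, f (x + Pi.single i 1) ^ 2 * (1 - u x / u (x + Pi.single i 1)) := fun i => by
    rw [← (Equiv.addRight (Pi.single i (1 : ℤ))).tsum_eq]
    exact tsum_congr fun x => by simp only [Equiv.coe_addRight, add_sub_cancel_right]
  simp only [Finset.mul_sum, mul_add]
  rw [Summable.tsum_finsetSum fun i _ => (hA i).add (hB i), dirichletForm]
  refine Finset.sum_le_sum fun i _ => ?_
  rw [(hA i).tsum_add (hB i), hshift, ← (hA i).tsum_add (hB' i)]
  have hle : ∀ x, f x ^ 2 * (1 - u (x + Pi.single i 1) / u x)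
      + f (x + Pi.single i 1) ^ 2 * (1 - u x / u (x + Pi.single i 1))
      ≤ 1 * ((f (x + Pi.single i 1) - f x) * (f (x + Pi.single i 1) - f x)) := fun x =>
    sq_mul_one_sub_div_add_le (hu _) (hu _) _ _
  have hs : Summable fun x =>
      (1 : ℝ) * ((f (x + Pi.single i 1) - f x) * (f (x + Pi.single i 1) - f x)) :=
    summable_dirichletForm (fun _ _ => 1) hf i
  exact ((hA i).add (hB' i)).tsum_le_tsum hle hs

/-- A positive superharmonic function `u` yields a Hardy inequality at the origin. -/
theorem sq_mul_le_dirichletForm {u : (Fin d → ℤ) → ℝ} (hu : ∀ x, 0 < u x)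
    (hsuper : ∀ x, ∑ i, (u (x + Pi.single i 1) + u (x - Pi.single i 1)) ≤ 2 * d * u x)
    (hf : f.support.Finite) :
    f 0 ^ 2 * (2 * d - (∑ i, (u (0 + Pi.single i 1) + u (0 - Pi.single i 1))) / u 0)
      ≤ dirichletForm (fun _ _ => 1) f f := by
  have hV : ∀ x, ∑ i, ((1 - u (x + Pi.single i 1) / u x) + (1 - u (x - Pi.single i 1) / u x))
      = 2 * d - (∑ i, (u (x + Pi.single i 1) + u (x - Pi.single i 1))) / u x := by
    intro x
    rw [Finset.sum_div, show (2 * d : ℝ) = ∑ _i : Fin d, (2 : ℝ) by simp [mul_comm],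
      ← Finset.sum_sub_distrib]
    exact Finset.sum_congr rfl fun i _ => by ring
  have hV0 : ∀ x, 0 ≤ f x ^ 2 * ∑ i, ((1 - u (x + Pi.single i 1) / u x)
      + (1 - u (x - Pi.single i 1) / u x)) := fun x => by
    rw [hV]
    exact mul_nonneg (sq_nonneg _) (sub_nonneg.2 ((div_le_iff₀ (hu x)).2 (hsuper x)))
  have hsV : Summable fun x => f x ^ 2 * ∑ i, ((1 - u (x + Pi.single i 1) / u x)
      + (1 - u (x - Pi.single i 1) / u x)) :=
    summable_of_support hf fun x hx => by rw [hx]; ring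
  rw [← hV]
  exact (hsV.le_tsum 0 fun x _ => hV0 x).trans (tsum_sq_mul_le_dirichletForm hu hf)

/-- The Taylor expansion of `(1 + t)^(-1/4)` has quadratic coefficient `5/32 = 10/64`; raising it to
`11/64` absorbs the remainder for small `t`. -/
theorem inv_sqrt_sqrt_one_add_le {t : ℝ} (ht : |t| ≤ 1 / 16) :
    (√√(1 + t))⁻¹ ≤ 1 - t / 4 + 11 / 64 * t ^ 2 := by
  obtain ⟨h1, h2⟩ := abs_le.1 ht
  set v := √√(1 + t) with hv
  have hv0 : 0 < v := Real.sqrt_pos.2 (Real.sqrt_pos.2 (by linarith))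
  have hv4 : v ^ 4 = 1 + t := by
    rw [show v ^ 4 = (v ^ 2) ^ 2 by ring, hv, Real.sq_sqrt (Real.sqrt_nonneg _),
      Real.sq_sqrt (by linarith)]
  have hl : 49 / 50 ≤ v := by
    by_contra! h
    have := pow_lt_pow_left₀ h hv0.le (n := 4) (by norm_num)
    norm_num at this; linarith
  have hr : v ≤ 51 / 50 := by
    by_contra! h
    have := pow_lt_pow_left₀ h (by norm_num) (n := 4) (by norm_num)
    norm_num at this; linarith
  rw [inv_le_iff_one_le_mul₀ hv0]
  obtain ⟨w, hw⟩ : ∃ w, v = 1 + w := ⟨v - 1, by ring⟩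
  have ht' : t = (1 + w) ^ 4 - 1 := by rw [← hw]; linarith
  rw [ht', hw]
  -- In terms of `w` the required inequality is `w ^ 2` times the expression in `hw2`. That
  -- expression equals `1/4` at `w = 0`; with coefficient `5/32` it would vanish there.
  have hw1 : |w| ≤ 1 / 50 := abs_le.2 ⟨by linarith, by linarith⟩
  have hw2 : 0 ≤ (1 + w) * (11 / 64 * (4 + 6 * w + 4 * w ^ 2 + w ^ 3) ^ 2
      - (3 / 2 + w + w ^ 2 / 4)) - 1 := by
    obtain ⟨h3, h4⟩ := abs_le.1 hw1
    have h5 : 0 ≤ (w + 1 / 50) * (1 / 50 - w) := mul_nonneg (by linarith) (by linarith)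
    have h6 : w ^ 2 ≤ 1 / 2500 := by nlinarith
    have h7 : 387 / 100 ≤ 4 + 6 * w + 4 * w ^ 2 + w ^ 3 := by nlinarith
    have h8 : (387 / 100) ^ 2 ≤ (4 + 6 * w + 4 * w ^ 2 + w ^ 3) ^ 2 :=
      pow_le_pow_left₀ (by norm_num) h7 2
    nlinarith
  nlinarith [mul_nonneg (sq_nonneg w) hw2]

/-- A function that is superharmonic for the simple random walk in dimension at least three. -/
noncomputable def invQuarticRadius {d : ℕ} (x : Fin d → ℤ) : ℝ :=
  (√√(∑ i, (x i : ℝ) ^ 2 + 4096))⁻¹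

theorem sum_sq_add_single (x : Fin d → ℤ) (i : Fin d) (s : ℤ) :
    ∑ j, (((x + Pi.single i s : Fin d → ℤ) j : ℤ) : ℝ) ^ 2
      = ∑ j, (x j : ℝ) ^ 2 + (2 * s * x i + s ^ 2) := by
  rw [← Finset.add_sum_erase _ _ (Finset.mem_univ i),
    ← Finset.add_sum_erase _ (fun j => (x j : ℝ) ^ 2) (Finset.mem_univ i)]
  have : ∑ j ∈ Finset.univ.erase i, (((x + Pi.single i s : Fin d → ℤ) j : ℤ) : ℝ) ^ 2
      = ∑ j ∈ Finset.univ.erase i, (x j : ℝ) ^ 2 := by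
    refine Finset.sum_congr rfl fun j hj => ?_
    rw [Pi.add_apply, Pi.single_eq_of_ne (Finset.ne_of_mem_erase hj), add_zero]
  rw [this, Pi.add_apply, Pi.single_eq_same]
  push_cast
  ring

theorem invQuarticRadius_pos (x : Fin d → ℤ) : 0 < invQuarticRadius x := by
  have : 0 ≤ ∑ i, (x i : ℝ) ^ 2 := Finset.sum_nonneg fun i _ => sq_nonneg _
  exact inv_pos.2 (Real.sqrt_pos.2 (Real.sqrt_pos.2 (by linarith)))

theorem invQuarticRadius_add_single_le (x : Fin d → ℤ) (i : Fin d) {s : ℤ} (hs : s = 1 ∨ s = -1)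
    {r t : ℝ} (hr : r = ∑ j, (x j : ℝ) ^ 2 + 4096) (ht : t = (2 * s * x i + 1) / r) :
    invQuarticRadius (x + Pi.single i s)
      ≤ invQuarticRadius x * (1 - t / 4 + 11 / 64 * t ^ 2) := by
  have hi : (x i : ℝ) ^ 2 ≤ ∑ j, (x j : ℝ) ^ 2 :=
    Finset.single_le_sum (f := fun j => (x j : ℝ) ^ 2) (fun j _ => sq_nonneg _) (Finset.mem_univ i)
  have hr0 : 0 < r := by nlinarith [sq_nonneg (x i : ℝ)]
  have hs2 : (s : ℝ) ^ 2 = 1 := by rcases hs with rfl | rfl <;> norm_num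
  -- `2|x i| ≤ (x i)² / 16 + 16` by completing the square; the constant 4096 leaves ample room for
  -- the remaining terms.
  have ht1 : |t| ≤ 1 / 16 := by
    rw [ht, abs_div, abs_of_pos hr0, div_le_iff₀ hr0, abs_le]
    rcases hs with rfl | rfl <;> push_cast <;> constructor <;>
      nlinarith [sq_nonneg ((x i : ℝ) - 16), sq_nonneg ((x i : ℝ) + 16)]
  have he : ∑ j, (((x + Pi.single i s : Fin d → ℤ) j : ℤ) : ℝ) ^ 2 + 4096 = r * (1 + t) := by
    rw [sum_sq_add_single, hs2, mul_add, mul_one, ht, mul_div_cancel₀ _ hr0.ne', hr]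
    ring
  rw [invQuarticRadius, invQuarticRadius, he, ← hr, Real.sqrt_mul hr0.le,
    Real.sqrt_mul (Real.sqrt_nonneg _), mul_inv]
  exact mul_le_mul_of_nonneg_left (inv_sqrt_sqrt_one_add_le ht1) (by positivity)

/-- With `r = |x|² + 4096`, the first-order terms of the two steps in direction `i` add up to `-1 /
(2r)`, and the quadratic ones to `(11/8 * (x i)² + 11/32) / r²`. Summed over `i`, the negative part
`-d / (2r)` dominates because the decay exponent `1/2` is smaller than `d - 2`. -/
theorem invQuarticRadius_superharmonic (hd : 3 ≤ d) (x : Fin d → ℤ) :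
    ∑ i, (invQuarticRadius (x + Pi.single i 1) + invQuarticRadius (x - Pi.single i 1))
      < 2 * d * invQuarticRadius x := by
  set q := ∑ j, (x j : ℝ) ^ 2 with hq
  have hq0 : 0 ≤ q := Finset.sum_nonneg fun i _ => sq_nonneg _
  have hd' : (3 : ℝ) ≤ d := by exact_mod_cast hd
  have hr0 : 0 < q + 4096 := by linarith
  have hstep : ∀ i, invQuarticRadius (x + Pi.single i 1) + invQuarticRadius (x - Pi.single i 1)
      ≤ invQuarticRadius x * ((2 - 1 / (2 * (q + 4096)) + 11 / 32 / (q + 4096) ^ 2)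
        + 11 / 8 / (q + 4096) ^ 2 * (x i : ℝ) ^ 2) := by
    intro i
    have h1 := invQuarticRadius_add_single_le x i (Or.inl rfl) rfl rfl
    have h2 := invQuarticRadius_add_single_le x i (Or.inr rfl) rfl rfl
    rw [Pi.single_neg, ← sub_eq_add_neg] at h2
    rw [← hq] at h1 h2
    refine (add_le_add h1 h2).trans (le_of_eq ?_)
    rw [← mul_add]
    congr 1
    push_cast
    field_simp
    ring
  refine (Finset.sum_le_sum fun i _ => hstep i).trans_lt ?_
  rw [← Finset.mul_sum, Finset.sum_add_distrib, ← Finset.mul_sum, ← hq, mul_comm _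
    (invQuarticRadius x)]
  refine mul_lt_mul_of_pos_left ?_ (invQuarticRadius_pos x)
  simp only [Finset.sum_const, Finset.card_univ, Fintype.card_fin, nsmul_eq_mul]
  -- The dimension enters here: `d / 2 ≥ 3 / 2 > 11 / 8`.
  have h3 : 11 / 8 * q + 11 / 32 * d < d * (q + 4096) / 2 := by nlinarith
  have h4 : (11 / 8 * q + 11 / 32 * d) / (q + 4096) ^ 2 < d / (2 * (q + 4096)) := by
    rw [div_lt_div_iff₀ (by positivity) (by positivity)]
    nlinarith
  have h5 : d * (2 - 1 / (2 * (q + 4096)) + 11 / 32 / (q + 4096) ^ 2)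
      + 11 / 8 / (q + 4096) ^ 2 * q
      = 2 * d + ((11 / 8 * q + 11 / 32 * d) / (q + 4096) ^ 2 - d / (2 * (q + 4096))) := by
    field_simp
    ring
  linarith

/-- In dimension at least three, point values are controlled by the Dirichlet form. -/
theorem exists_sq_le_mul_dirichletForm (hd : 3 ≤ d) :
    ∃ B : ℝ, 0 ≤ B ∧ ∀ f : (Fin d → ℤ) → ℝ, f.support.Finite →
      f 0 ^ 2 ≤ B * dirichletForm (fun _ _ => 1) f f := by
  set V : ℝ := 2 * d - (∑ i, (invQuarticRadius ((0 : Fin d → ℤ) + Pi.single i 1)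
    + invQuarticRadius ((0 : Fin d → ℤ) - Pi.single i 1))) / invQuarticRadius (0 : Fin d → ℤ)
    with hV
  -- Strict superharmonicity at the origin makes the Hardy constant positive.
  have hV0 : 0 < V :=
    sub_pos.2 ((div_lt_iff₀ (invQuarticRadius_pos _)).2 (invQuarticRadius_superharmonic hd 0))
  refine ⟨V⁻¹, inv_nonneg.2 hV0.le, fun f hf => ?_⟩
  rw [← div_eq_inv_mul, le_div_iff₀ hV0]
  exact sq_mul_le_dirichletForm invQuarticRadius_pos
    (fun x => (invQuarticRadius_superharmonic hd x).le) hf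

end GroundState

/-! ### Zero capacity of the origin in dimension at most two. -/

section LogCutoff

variable {d : ℕ}

/-- The supremum norm on the lattice, with values in `ℕ`. -/
noncomputable def supNatAbs (x : Fin d → ℤ) : ℕ := Finset.univ.sup fun i => (x i).natAbs

/-- The box of radius `N` around the origin. -/
noncomputable def latticeBox (d N : ℕ) : Finset (Fin d → ℤ) :=
  Fintype.piFinset fun _ => Finset.Icc (-(N : ℤ)) N

theorem mem_latticeBox {N : ℕ} {x : Fin d → ℤ} : x ∈ latticeBox d N ↔ supNatAbs x ≤ N := by
  simp only [latticeBox, Fintype.mem_piFinset, Finset.mem_Icc, supNatAbs, Finset.sup_le_iff,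
    Finset.mem_univ, true_imp_iff]
  exact forall_congr' fun i => by omega

theorem card_latticeBox (N : ℕ) : (latticeBox d N).card = (2 * N + 1) ^ d := by
  rw [latticeBox, Fintype.card_piFinset_const, Int.card_Icc]
  congr 1
  omega

theorem supNatAbs_add_le (x v : Fin d → ℤ) : supNatAbs (x + v) ≤ supNatAbs x + supNatAbs v := by
  refine Finset.sup_le fun i _ => ?_
  have h1 : (x i).natAbs ≤ supNatAbs x :=
    Finset.le_sup (f := fun i => (x i).natAbs) (Finset.mem_univ i)
  have h2 : (v i).natAbs ≤ supNatAbs v :=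
    Finset.le_sup (f := fun i => (v i).natAbs) (Finset.mem_univ i)
  exact (Int.natAbs_add_le _ _).trans (add_le_add h1 h2)

theorem supNatAbs_single_le (i : Fin d) {s : ℤ} (hs : s.natAbs = 1) :
    supNatAbs (Pi.single i s) ≤ 1 := by
  refine Finset.sup_le fun j _ => ?_
  rcases eq_or_ne j i with rfl | h
  · simp [hs]
  · simp [Pi.single_eq_of_ne h]

/-- The harmonic numbers as reals. -/
noncomputable def harmonicSum (n : ℕ) : ℝ := ∑ j ∈ Finset.range n, 1 / ((j : ℝ) + 1)

theorem harmonicSum_succ (n : ℕ) : harmonicSum (n + 1) = harmonicSum n + 1 / ((n : ℝ) + 1) :=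
  Finset.sum_range_succ _ _

theorem harmonicSum_mono : Monotone harmonicSum :=
  monotone_nat_of_le_succ fun n => by
    rw [harmonicSum_succ]; exact le_add_of_nonneg_right (by positivity)

/-- The shell of radius `N + 1` has at most `(2N+3)² - (2N+1)² = 8(N+1)` points, each contributing
`1 / (N+1)²`. The initial `1` is the origin. -/
theorem sum_latticeBox_le (hd : d ≤ 2) (N : ℕ) :
    ∑ x ∈ latticeBox d N, (1 / (max 1 (supNatAbs x : ℝ)) ^ 2) ≤ 1 + 8 * harmonicSum N := by
  induction N with
  | zero =>
    refine (Finset.sum_le_card_nsmul _ _ 1 fun x _ => ?_).trans ?_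
    · rw [div_le_one (by positivity)]
      exact one_le_pow₀ (le_max_left _ _)
    · rw [card_latticeBox]; simp [harmonicSum]
  | succ N ih =>
    have hsub : latticeBox d N ⊆ latticeBox d (N + 1) := fun x hx =>
      mem_latticeBox.2 ((mem_latticeBox.1 hx).trans N.le_succ)
    rw [← Finset.sum_sdiff hsub, harmonicSum_succ]
    have hcard : ((latticeBox d (N + 1) \ latticeBox d N).card : ℝ) ≤ 8 * (N + 1) := by
      have : (latticeBox d (N + 1) \ latticeBox d N).card ≤ 8 * (N + 1) := by
        rw [Finset.card_sdiff_of_subset hsub, card_latticeBox, card_latticeBox, Nat.sub_le_iff_le_add]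
        interval_cases d <;> ring_nf <;> omega
      exact_mod_cast this
    have h1 : ∑ x ∈ latticeBox d (N + 1) \ latticeBox d N, (1 / (max 1 (supNatAbs x : ℝ)) ^ 2)
        ≤ (latticeBox d (N + 1) \ latticeBox d N).card • (1 / ((N : ℝ) + 1) ^ 2) := by
      refine Finset.sum_le_card_nsmul _ _ _ fun x hx => ?_
      rw [Finset.mem_sdiff, mem_latticeBox, mem_latticeBox] at hx
      have : supNatAbs x = N + 1 := by omega
      rw [this]
      refine one_div_le_one_div_of_le (by positivity) (pow_le_pow_left₀ (by positivity) ?_ _)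
      push_cast
      exact le_max_right _ _
    rw [nsmul_eq_mul] at h1
    have h2 := mul_le_mul_of_nonneg_right hcard
      (show (0 : ℝ) ≤ 1 / ((N : ℝ) + 1) ^ 2 by positivity)
    have h3 : 8 * ((N : ℝ) + 1) * (1 / ((N : ℝ) + 1) ^ 2) = 8 * (1 / ((N : ℝ) + 1)) := by
      field_simp
    linarith

/-- The logarithmic cutoff at radius `N`. -/
noncomputable def logCutoff (N : ℕ) (x : Fin d → ℤ) : ℝ :=
  max (1 - harmonicSum (supNatAbs x) / harmonicSum N) 0

theorem logCutoff_eq_zero {N : ℕ} (hN : 0 < harmonicSum N) {x : Fin d → ℤ}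
    (hx : N ≤ supNatAbs x) : logCutoff N x = 0 :=
  max_eq_right (sub_nonpos.2 ((one_le_div hN).2 (harmonicSum_mono hx)))

theorem finite_support_logCutoff {N : ℕ} (hN : 0 < harmonicSum N) :
    (logCutoff N : (Fin d → ℤ) → ℝ).support.Finite := by
  refine (latticeBox d N).finite_toSet.subset fun x hx => ?_
  by_contra h
  exact hx (logCutoff_eq_zero hN (le_of_not_ge fun h' => h (mem_latticeBox.2 h')))

theorem logCutoff_zero (N : ℕ) : logCutoff N (0 : Fin d → ℤ) = 1 := by
  have : supNatAbs (0 : Fin d → ℤ) = 0 := Nat.le_zero.1 (Finset.sup_le fun i _ => by simp)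
  simp [logCutoff, this, harmonicSum]

theorem abs_harmonicSum_sub_le {k l : ℕ} (h1 : k ≤ l + 1) (h2 : l ≤ k + 1) :
    |harmonicSum l - harmonicSum k| ≤ 1 / max 1 (k : ℝ) := by
  obtain rfl | rfl | rfl : l = k ∨ l = k + 1 ∨ k = l + 1 := by omega
  · simp
  · rw [harmonicSum_succ, add_sub_cancel_left, abs_of_nonneg (by positivity)]
    refine one_div_le_one_div_of_le (by positivity) (max_le ?_ ?_) <;> simp
  · rw [harmonicSum_succ, sub_add_cancel_left, abs_neg, abs_of_nonneg (by positivity)]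
    refine one_div_le_one_div_of_le (by positivity) (max_le ?_ ?_) <;> simp

theorem sq_logCutoff_sub_le {N : ℕ} (hN : 0 < harmonicSum N) (x : Fin d → ℤ) (i : Fin d) :
    (logCutoff N (x + Pi.single i 1) - logCutoff N x) ^ 2
      ≤ if x ∈ latticeBox d N then (harmonicSum N ^ 2)⁻¹ * (1 / (max 1 (supNatAbs x : ℝ)) ^ 2)
        else 0 := by
  have h1 : supNatAbs (x + Pi.single i 1) ≤ supNatAbs x + 1 :=
    (supNatAbs_add_le _ _).trans (add_le_add_right (supNatAbs_single_le i rfl) _)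
  have h2 : supNatAbs x ≤ supNatAbs (x + Pi.single i 1) + 1 := by
    have := (supNatAbs_add_le (x + Pi.single i 1) (Pi.single i (-1))).trans
      (add_le_add_right (supNatAbs_single_le i rfl) _)
    rwa [Pi.single_neg, add_neg_cancel_right] at this
  split_ifs with hx
  · have h3 : |logCutoff N (x + Pi.single i 1) - logCutoff N x|
        ≤ 1 / max 1 (supNatAbs x : ℝ) / harmonicSum N := by
      refine (abs_max_sub_max_le_abs _ _ _).trans ?_
      rw [sub_sub_sub_cancel_left, ← sub_div, abs_div, abs_of_pos hN, abs_sub_comm]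
      exact div_le_div_of_nonneg_right (abs_harmonicSum_sub_le h2 h1) hN.le
    rw [← sq_abs]
    refine (pow_le_pow_left₀ (abs_nonneg _) h3 2).trans (le_of_eq ?_)
    rw [div_pow, div_pow, one_pow, div_eq_inv_mul]
  -- Outside the box the radius is at least `N + 1`, so the neighbour still has radius at least `N`
  -- and both values vanish.
  · rw [mem_latticeBox] at hx
    rw [logCutoff_eq_zero hN (by omega), logCutoff_eq_zero hN (by omega)]
    simp

/-- The squared gradient is of order `(harmonicSum N * |x|)⁻²`, and `|x|⁻²` sums to order
`harmonicSum N` over the box, so the energy is of order `1 / harmonicSum N`. -/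
theorem dirichletForm_logCutoff_le (hd : d ≤ 2) {N : ℕ} (hN : 0 < harmonicSum N) :
    dirichletForm (fun _ _ => 1) (logCutoff N : (Fin d → ℤ) → ℝ) (logCutoff N)
      ≤ d * ((harmonicSum N ^ 2)⁻¹ * (1 + 8 * harmonicSum N)) := by
  have : ∀ i ∈ (Finset.univ : Finset (Fin d)), ∑' x : Fin d → ℤ, (1 : ℝ) *
      ((logCutoff N (x + Pi.single i 1) - logCutoff N x) *
        (logCutoff N (x + Pi.single i 1) - logCutoff N x))
      ≤ (harmonicSum N ^ 2)⁻¹ * (1 + 8 * harmonicSum N) := by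
    intro i _
    have hs : Summable fun x : Fin d → ℤ => if x ∈ latticeBox d N then
        (harmonicSum N ^ 2)⁻¹ * (1 / (max 1 (supNatAbs x : ℝ)) ^ 2) else 0 :=
      summable_of_ne_finset_zero (s := latticeBox d N) fun x hx => if_neg hx
    refine ((summable_dirichletForm (fun _ _ => 1) (finite_support_logCutoff hN) i).tsum_le_tsum
      (fun x => ?_) hs).trans ?_
    · rw [one_mul, ← pow_two]; exact sq_logCutoff_sub_le hN x i
    · rw [tsum_eq_sum (s := latticeBox d N) fun x hx => if_neg hx, Finset.sum_ite_mem,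
        Finset.inter_self, ← Finset.mul_sum]
      exact mul_le_mul_of_nonneg_left (sum_latticeBox_le hd N) (by positivity)
  refine (Finset.sum_le_card_nsmul _ _ _ this).trans (le_of_eq ?_)
  simp

/-- In dimension at most two, the origin has capacity zero. -/
theorem exists_dirichletForm_lt (hd : d ≤ 2) {ε : ℝ} (hε : 0 < ε) :
    ∃ f : (Fin d → ℤ) → ℝ, f.support.Finite ∧ f 0 = 1 ∧
      dirichletForm (fun _ _ => 1) f f < ε := by
  -- The summand `1` forces `harmonicSum N ≥ 1`, so that `1 + 8 * harmonicSum N ≤ 9 * harmonicSum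
  -- N`; the energy is then at most `9 * d / harmonicSum N < ε`.
  obtain ⟨N, hN⟩ := (Real.tendsto_sum_range_one_div_nat_succ_atTop.eventually_gt_atTop
    (1 + d * 9 / ε)).exists
  change 1 + d * 9 / ε < harmonicSum N at hN
  have h0 : 0 ≤ d * 9 / ε := by positivity
  have h1 : 0 < harmonicSum N := by linarith
  refine ⟨logCutoff N, finite_support_logCutoff h1, logCutoff_zero N,
    (dirichletForm_logCutoff_le hd h1).trans_lt ?_⟩
  have h2 : d * 9 < ε * harmonicSum N := by
    rw [← div_lt_iff₀' hε]; linarith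
  rw [← div_eq_inv_mul, ← mul_div_assoc, div_lt_iff₀ (by positivity)]
  have h3 : (1 : ℝ) ≤ harmonicSum N := by linarith
  have h4 : (d : ℝ) * (1 + 8 * harmonicSum N) ≤ d * 9 * harmonicSum N := by
    nlinarith [(Nat.cast_nonneg d : (0 : ℝ) ≤ d)]
  nlinarith

end LogCutoff

/-! ### Transfer of both dimension results to the walk by comparing conductances. -/

namespace IsModelFive

variable {d : ℕ} {α : Fin d → ℝ} {c : ℝ} {M : ℕ} {up down : Fin d → ℤ → ℝ}

theorem exists_greenFun_le (h : IsModelFive α c M up down) (hd : 3 ≤ d) :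
    ∃ B, ∀ n, greenFun up down n 0 ≤ B := by
  obtain ⟨a, _, ha, hab⟩ := h.conductance_bounded
  obtain ⟨B, hB0, hB⟩ := exists_sq_le_mul_dirichletForm hd
  refine ⟨B * a⁻¹, h.greenFun_le (fun f hf => (hB f hf).trans ?_) (by positivity)⟩
  rw [mul_assoc]
  refine mul_le_mul_of_nonneg_left ?_ hB0
  rw [← div_eq_inv_mul, le_div_iff₀' ha, ← dirichletForm_const_mul]
  exact dirichletForm_mono (fun i x => by simpa using (hab i x).1) hf

theorem not_greenFun_le (h : IsModelFive α c M up down) (hd : d ≤ 2) (B : ℝ) :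
    ¬ ∀ n, greenFun up down n 0 ≤ B := by
  obtain ⟨_, b, -, hab⟩ := h.conductance_bounded
  refine h.not_bounded_greenFun (fun ε hε => ?_) B
  have hb : 0 < |b| + 1 := by positivity
  obtain ⟨f, hf, hf0, hfe⟩ := exists_dirichletForm_lt (d := d) hd (div_pos hε hb)
  refine ⟨f, hf, hf0, ?_⟩
  rw [lt_div_iff₀' hb, ← dirichletForm_const_mul] at hfe
  refine (dirichletForm_mono (fun i x => ?_) hf).trans_lt hfe
  rw [mul_one]
  exact (hab i x).2.trans ((le_abs_self b).trans (by linarith))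

end IsModelFive

/-! ### The transition kernel and its finite-horizon probabilities. -/

section StepProb

variable {d : ℕ} {up down : Fin d → ℤ → ℝ}

theorem hasSum_stepProb_mul (f : (Fin d → ℤ) → ℝ) (x : Fin d → ℤ) :
    HasSum (fun y => stepProb up down x y * f y) (transition up down f x) := by
  have hite : ∀ (z : Fin d → ℤ) (r : ℝ), HasSum (fun y => if y = z then r * f z else 0) (r * f z) :=
    fun z r => hasSum_ite_eq z _
  have h := (hasSum_sum (s := Finset.univ) fun i _ =>
    (hite (x + Pi.single i 1) (up i (x i))).add (hite (x - Pi.single i 1) (down i (x i)))).add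
      (hite x (1 - ∑ i, (up i (x i) + down i (x i))))
  convert h using 1
  · funext y
    simp only [stepProb, add_mul, Finset.sum_mul, ite_mul, zero_mul]
    congr 1
    · refine Finset.sum_congr rfl fun i _ => ?_
      congr 1 <;> split_ifs with hy <;> simp [hy]
    · split_ifs with hy <;> simp [hy]
  · rw [transition, generator, sub_mul, one_mul, Finset.sum_mul, add_sub_assoc', add_comm _ (f x),
      add_sub_assoc, ← Finset.sum_sub_distrib]
    congr 1
    exact Finset.sum_congr rfl fun i _ => by ring

/-- The function `x ↦ P_x(S_1, …, S_n ∈ W, S_n ∈ T)`. -/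
noncomputable def constrainedProb (up down : Fin d → ℤ → ℝ) (W T : Set (Fin d → ℤ)) :
    ℕ → (Fin d → ℤ) → ℝ
  | 0 => T.indicator 1
  | n + 1 => transition up down (W.indicator (constrainedProb up down W T n))

/-- The other choice needed later, `W = {0}ᶜ` and `T = univ`, gives the probability of no return;
since `W` constrains only times from one on, the start at the origin is allowed. -/
theorem constrainedProb_univ (n : ℕ) :
    constrainedProb up down Set.univ {0} n = hitProb up down n := by
  induction n with
  | zero =>
    funext x
    rw [constrainedProb, hitProb, Function.iterate_zero, id]
    by_cases hx : x = 0
    · simp [hx]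
    · simp [hx]
  | succ n ih => rw [constrainedProb, Set.indicator_univ, ih, hitProb_succ]

end StepProb

/-! ### Path, future and last-visit events. -/

section Events

variable {Ω : Type*} {d : ℕ} {S : ℕ → Ω → (Fin d → ℤ)}

/-- The event that the walk is in `W` at the times `t + 1, …, t + n` and in `T` at time `t + n`. -/
def futureEvent (S : ℕ → Ω → (Fin d → ℤ)) (W T : Set (Fin d → ℤ)) (t n : ℕ) : Set Ω :=
  {ω | (∀ s, t < s → s ≤ t + n → S s ω ∈ W) ∧ S (t + n) ω ∈ T}

/-- The event that the walk follows the path `x` up to time `t`. -/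
def pathEvent (S : ℕ → Ω → (Fin d → ℤ)) (x : ℕ → (Fin d → ℤ)) (t : ℕ) : Set Ω :=
  {ω | ∀ s ≤ t, S s ω = x s}

theorem futureEvent_succ (W T : Set (Fin d → ℤ)) (t n : ℕ) :
    futureEvent S W T t (n + 1) = {ω | S (t + 1) ω ∈ W} ∩ futureEvent S W T (t + 1) n := by
  ext ω
  have e : t + (n + 1) = t + 1 + n := by omega
  simp only [futureEvent, Set.mem_inter_iff, Set.mem_ofPred_eq, e]
  constructor
  · rintro ⟨h1, h2⟩
    exact ⟨h1 _ (by omega) (by omega), fun s hs hs' => h1 s (by omega) hs', h2⟩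
  · rintro ⟨h0, h1, h2⟩
    refine ⟨fun s hs hs' => ?_, h2⟩
    rcases Nat.lt_or_ge (t + 1) s with h | h
    · exact h1 s h hs'
    · obtain rfl : s = t + 1 := by omega
      exact h0

theorem pathEvent_update (x : ℕ → (Fin d → ℤ)) (t : ℕ) (y : Fin d → ℤ) :
    pathEvent S (Function.update x (t + 1) y) (t + 1) = pathEvent S x t ∩ S (t + 1) ⁻¹' {y} := by
  ext ω
  simp only [pathEvent, Set.mem_inter_iff, Set.mem_ofPred_eq, Set.mem_preimage,
    Set.mem_singleton_iff]
  constructor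
  · intro h
    refine ⟨fun s hs => ?_, by simpa using h (t + 1) le_rfl⟩
    simpa [Function.update_of_ne (show s ≠ t + 1 by omega)] using h s (by omega)
  · rintro ⟨h1, h2⟩ s hs
    rcases eq_or_ne s (t + 1) with rfl | hne
    · simpa using h2
    · rw [Function.update_of_ne hne]
      exact h1 s (by omega)

/-- The event that `t` is the last time at which the walk is at the origin. -/
def lastVisit (S : ℕ → Ω → (Fin d → ℤ)) (t : ℕ) : Set Ω :=
  {ω | S t ω = 0 ∧ ∀ s, t < s → S s ω ≠ 0}

/-- The Markov property concerns finite horizons; this expresses the infinite-horizon event through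
them. -/
theorem lastVisit_eq_iInter (t : ℕ) :
    lastVisit S t = ⋂ n, S t ⁻¹' {0} ∩ futureEvent S {0}ᶜ Set.univ t n := by
  ext ω
  simp only [lastVisit, futureEvent, Set.mem_iInter, Set.mem_inter_iff, Set.mem_ofPred_eq,
    Set.mem_preimage, Set.mem_singleton_iff, Set.mem_compl_iff, Set.mem_univ, and_true]
  exact ⟨fun h n => ⟨h.1, fun s hs _ => h.2 s hs⟩,
    fun h => ⟨(h 0).1, fun s hs => (h s).2 s hs (by omega)⟩⟩

end Events

/-! ### The Markov property and the two criteria for the number of visits. -/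

section Markov

variable {Ω : Type*} [MeasurableSpace Ω] {μ : Measure Ω} [IsProbabilityMeasure μ]

theorem hasSum_measureReal_inter_fiber {X : Type*} [Countable X] [MeasurableSpace X]
    [MeasurableSingletonClass X] {Y : Ω → X} (hY : Measurable Y) {A : Set Ω}
    (hA : MeasurableSet A) : HasSum (fun y => μ.real (A ∩ Y ⁻¹' {y})) (μ.real A) := by
  have hU : A = ⋃ y, A ∩ Y ⁻¹' {y} := by
    rw [← Set.inter_iUnion, ← Set.preimage_iUnion, Set.iUnion_of_singleton, Set.preimage_univ,
      Set.inter_univ]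
  have hm : μ A = ∑' y, μ (A ∩ Y ⁻¹' {y}) := by
    conv_lhs => rw [hU]
    refine measure_iUnion (fun y z hyz => ?_) fun y => hA.inter (hY (measurableSet_singleton y))
    exact Set.disjoint_left.2 fun ω h1 h2 => hyz (h1.2.symm.trans h2.2)
  have hne : ∑' y, μ (A ∩ Y ⁻¹' {y}) ≠ ⊤ := hm ▸ measure_ne_top μ A
  have := ENNReal.hasSum_toReal hne
  rwa [← ENNReal.tsum_toReal_eq fun y => measure_ne_top μ _, ← hm] at this

variable {d : ℕ} {up down : Fin d → ℤ → ℝ} {S : ℕ → Ω → (Fin d → ℤ)}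

theorem measurableSet_futureEvent (hS : ∀ t, Measurable (S t)) (W T : Set (Fin d → ℤ))
    (t n : ℕ) : MeasurableSet (futureEvent S W T t n) := by
  have h : ∀ s (U : Set (Fin d → ℤ)), MeasurableSet {ω | S s ω ∈ U} := fun s U =>
    hS s U.to_countable.measurableSet
  have : futureEvent S W T t n
      = (⋂ s, ⋂ (_ : t < s), ⋂ (_ : s ≤ t + n), {ω | S s ω ∈ W}) ∩ {ω | S (t + n) ω ∈ T} := by
    ext ω; simp [futureEvent]
  rw [this]
  exact (MeasurableSet.iInter fun s => MeasurableSet.iInter fun _ => MeasurableSet.iInter fun _ =>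
    h s W).inter (h _ T)

theorem measurableSet_pathEvent (hS : ∀ t, Measurable (S t)) (x : ℕ → (Fin d → ℤ)) (t : ℕ) :
    MeasurableSet (pathEvent S x t) := by
  have : pathEvent S x t = ⋂ s, ⋂ (_ : s ≤ t), S s ⁻¹' {x s} := by
    ext ω; simp [pathEvent]
  rw [this]
  exact MeasurableSet.iInter fun s => MeasurableSet.iInter fun _ =>
    hS s (measurableSet_singleton _)

/-- The Markov property, conditionally on the path up to time `t`. -/
theorem measureReal_pathEvent_inter_futureEvent (hS : IsWalk μ (stepProb up down) S)
    (W T : Set (Fin d → ℤ)) (n t : ℕ) (x : ℕ → (Fin d → ℤ)) :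
    μ.real (pathEvent S x t ∩ futureEvent S W T t n)
      = μ.real (pathEvent S x t) * constrainedProb up down W T n (x t) := by
  induction n generalizing t x with
  | zero =>
    rw [constrainedProb]
    by_cases hx : x t ∈ T
    · rw [Set.indicator_of_mem hx, Pi.one_apply, mul_one]
      congr 1
      refine Set.inter_eq_left.2 fun ω hω => ⟨fun s h1 h2 => absurd h1 (not_lt.2 h2), ?_⟩
      rw [add_zero, hω t le_rfl]
      exact hx
    · rw [Set.indicator_of_notMem hx, mul_zero]
      have : pathEvent S x t ∩ futureEvent S W T t 0 = ∅ := by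
        refine Set.eq_empty_of_forall_notMem fun ω hω => hx ?_
        have := hω.2.2
        rwa [add_zero, hω.1 t le_rfl] at this
      rw [this, measureReal_empty]
  | succ n ih =>
    -- First-step analysis: split by the position `y` at time `t + 1` and apply the induction
    -- hypothesis to the path prolonged by `y`.
    have h1 := hasSum_measureReal_inter_fiber (μ := μ) (hS.measurable (t + 1))
      ((measurableSet_pathEvent hS.measurable x t).inter
        (measurableSet_futureEvent hS.measurable W T t (n + 1)))
    have h2 := (hasSum_stepProb_mul (up := up) (down := down)
      (W.indicator (constrainedProb up down W T n)) (x t)).mul_left (μ.real (pathEvent S x t))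
    rw [constrainedProb]
    refine h1.tsum_eq.symm.trans ((tsum_congr fun y => ?_).trans h2.tsum_eq)
    rw [futureEvent_succ]
    by_cases hy : y ∈ W
    · have e : pathEvent S x t ∩ ({ω | S (t + 1) ω ∈ W} ∩ futureEvent S W T (t + 1) n)
            ∩ S (t + 1) ⁻¹' {y}
          = pathEvent S (Function.update x (t + 1) y) (t + 1) ∩ futureEvent S W T (t + 1) n := by
        rw [pathEvent_update]
        ext ω
        constructor
        · rintro ⟨⟨a, -, b⟩, c⟩
          exact ⟨⟨a, c⟩, b⟩
        · rintro ⟨⟨a, c⟩, b⟩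
          exact ⟨⟨a, by rw [Set.mem_ofPred_eq, show S (t + 1) ω = y from c]; exact hy, b⟩, c⟩
      have hstep := hS.step t (Function.update x (t + 1) y)
      have hpath : {ω | ∀ s ≤ t, S s ω = Function.update x (t + 1) y s} = pathEvent S x t := by
        ext ω
        refine forall₂_congr fun s hs => ?_
        rw [Function.update_of_ne (by omega)]
      rw [hpath, Function.update_self, Function.update_of_ne (by omega)] at hstep
      rw [e, ih, Function.update_self, Set.indicator_of_mem hy, ← mul_assoc]
      congr 1
    · rw [Set.indicator_of_notMem hy, mul_zero, mul_zero]
      have : pathEvent S x t ∩ ({ω | S (t + 1) ω ∈ W} ∩ futureEvent S W T (t + 1) n)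
            ∩ S (t + 1) ⁻¹' {y} = ∅ := by
        refine Set.eq_empty_of_forall_notMem fun ω hω => hy ?_
        have h3 : S (t + 1) ω = y := hω.2
        exact h3 ▸ hω.1.2.1
      rw [this, measureReal_empty]

/-- The Markov property, conditionally on the position at time `t`. -/
theorem measureReal_inter_futureEvent (hS : IsWalk μ (stepProb up down) S)
    (W T : Set (Fin d → ℤ)) (n t : ℕ) (y : Fin d → ℤ) :
    μ.real (S t ⁻¹' {y} ∩ futureEvent S W T t n)
      = μ.real (S t ⁻¹' {y}) * constrainedProb up down W T n y := by
  let hist : Ω → (Fin (t + 1) → Fin d → ℤ) := fun ω s => S s ω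
  have hhist : Measurable hist := measurable_pi_lambda _ fun s => hS.measurable s
  have hy : MeasurableSet (S t ⁻¹' {y}) := hS.measurable t (measurableSet_singleton y)
  have h1 := hasSum_measureReal_inter_fiber (μ := μ) hhist
    (hy.inter (measurableSet_futureEvent hS.measurable W T t n))
  have h2 := (hasSum_measureReal_inter_fiber (μ := μ) hhist hy).mul_right
    (constrainedProb up down W T n y)
  refine h1.tsum_eq.symm.trans ((tsum_congr fun z => ?_).trans h2.tsum_eq)
  -- `Fin.ofNat` reduces modulo `t + 1`, so `x` extends the history `z` periodically; only times `s
  -- ≤ t` matter.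
  set x : ℕ → (Fin d → ℤ) := fun s => z (Fin.ofNat (t + 1) s) with hx
  have hz : hist ⁻¹' {z} = pathEvent S x t := by
    ext ω
    simp only [Set.mem_preimage, Set.mem_singleton_iff, pathEvent, Set.mem_ofPred_eq, funext_iff,
      hist, hx]
    constructor
    · intro h s hs i
      have := h (Fin.ofNat (t + 1) s) i
      rwa [Fin.val_ofNat, Nat.mod_eq_of_lt (by omega)] at this
    · intro h s i
      have := h s (by omega) i
      rwa [Fin.ofNat_val_eq_self] at this
  rw [hz]
  by_cases hxy : x t = y
  · have e : pathEvent S x t ⊆ S t ⁻¹' {y} := fun ω hω => (hω t le_rfl).trans hxy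
    rw [Set.inter_eq_right.2 e, ← hxy, ← measureReal_pathEvent_inter_futureEvent hS, hxy,
      Set.inter_comm (S t ⁻¹' {y}), Set.inter_assoc, Set.inter_eq_right.2 e, Set.inter_comm]
  · have e : S t ⁻¹' {y} ∩ pathEvent S x t = ∅ :=
      Set.eq_empty_of_forall_notMem fun ω hω => hxy ((hω.2 t le_rfl).symm.trans hω.1)
    rw [Set.inter_right_comm, e, Set.empty_inter, measureReal_empty, zero_mul]

theorem measureReal_start (hS : IsWalk μ (stepProb up down) S) : μ.real (S 0 ⁻¹' {0}) = 1 := by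
  rw [Measure.real, (prob_compl_eq_zero_iff (hS.measurable 0 (measurableSet_singleton 0))).1
    hS.start, ENNReal.toReal_one]

theorem measureReal_eq_hitProb (hS : IsWalk μ (stepProb up down) S) (n : ℕ) :
    μ.real (S n ⁻¹' {0}) = hitProb up down n 0 := by
  have h := measureReal_inter_futureEvent hS Set.univ {0} n 0 0
  rw [constrainedProb_univ, measureReal_start hS, one_mul] at h
  rw [← h]
  refine measureReal_congr ?_
  filter_upwards [hS.start] with ω hω
  have : ω ∈ S n ⁻¹' {0} ↔ ω ∈ S 0 ⁻¹' {0} ∩ futureEvent S Set.univ {0} 0 n := by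
    simp [futureEvent, hω]
  exact propext this

theorem measurableSet_lastVisit (hS : ∀ t, Measurable (S t)) (t : ℕ) :
    MeasurableSet (lastVisit S t) := by
  rw [lastVisit_eq_iInter]
  exact MeasurableSet.iInter fun n => (hS t (measurableSet_singleton 0)).inter
    (measurableSet_futureEvent hS _ _ t n)

theorem tendsto_measureReal_lastVisit (hS : IsWalk μ (stepProb up down) S) (t : ℕ) :
    Tendsto (fun n => μ.real (S t ⁻¹' {0}) * constrainedProb up down {0}ᶜ Set.univ n 0) atTop
      (nhds (μ.real (lastVisit S t))) := by
  simp only [← measureReal_inter_futureEvent hS]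
  rw [lastVisit_eq_iInter]
  refine (ENNReal.tendsto_toReal (measure_ne_top μ _)).comp
    (tendsto_measure_iInter_atTop (fun n => ?_) (fun m n hmn => ?_) ⟨0, measure_ne_top μ _⟩)
  · exact ((hS.measurable t (measurableSet_singleton 0)).inter
      (measurableSet_futureEvent hS.measurable _ _ t n)).nullMeasurableSet
  · exact Set.inter_subset_inter_right _ fun ω hω =>
      ⟨fun s h1 h2 => hω.1 s h1 (by omega), trivial⟩

/-- After a visit the walk restarts: the no-return probability over each finite horizon is the same
from time `t` as from time `0`, and the limits agree. -/
theorem measureReal_lastVisit (hS : IsWalk μ (stepProb up down) S) (t : ℕ) :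
    μ.real (lastVisit S t) = μ.real (S t ⁻¹' {0}) * μ.real (lastVisit S 0) := by
  have h0 := tendsto_measureReal_lastVisit hS 0
  rw [measureReal_start hS] at h0
  simp only [one_mul] at h0
  exact tendsto_nhds_unique (tendsto_measureReal_lastVisit hS t) (h0.const_mul _)

theorem summable_measureReal_lastVisit (hS : ∀ t, Measurable (S t)) :
    Summable fun t => μ.real (lastVisit S t) := by
  have hdisj : Pairwise (Function.onFun Disjoint (lastVisit S)) := by
    intro s t hst
    refine Set.disjoint_left.2 fun ω h1 h2 => ?_
    rcases lt_or_gt_of_ne hst with h | h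
    · exact h1.2 t h h2.1
    · exact h2.2 s h h1.1
  refine ENNReal.summable_toReal ?_
  rw [← measure_iUnion hdisj (measurableSet_lastVisit hS)]
  exact measure_ne_top μ _

/-- A walk with infinite expected number of visits to the origin is recurrent. -/
theorem IsWalk.isRecurrent (hS : IsWalk μ (stepProb up down) S)
    (h : ¬ Summable fun t => μ.real (S t ⁻¹' {0})) : IsRecurrent μ S := by
  -- Last visits at different times are disjoint events, so `∑ t, P(S_t = 0) * P(no return)`
  -- converges. Divergence of `∑ t, P(S_t = 0)` forces the escape probability to vanish.
  have h0 : μ.real (lastVisit S 0) = 0 := by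
    by_contra hne
    refine h ?_
    have := (summable_measureReal_lastVisit (μ := μ) hS.measurable)
    exact (summable_mul_right_iff hne).1 (this.congr fun t => measureReal_lastVisit hS t)
  have hnull : ∀ t, ∀ᵐ ω ∂μ, ω ∉ lastVisit S t := fun t => by
    rw [← measure_eq_zero_iff_ae_notMem, ← measureReal_eq_zero_iff, measureReal_lastVisit hS, h0,
      mul_zero]
  filter_upwards [hS.start, ae_all_iff.2 hnull] with ω hω hlast
  rw [frequently_atTop]
  by_contra! hN
  obtain ⟨N, hN⟩ := hN
  -- A path that starts at the origin and visits it finitely often has a last visit, which almost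
  -- surely does not occur.
  have hspec := Nat.findGreatest_spec (P := fun t => S t ω = 0) (Nat.zero_le N) hω
  refine hlast (Nat.findGreatest (fun t => S t ω = 0) N) ⟨hspec, fun s hs => ?_⟩
  rcases le_total s N with hsN | hsN
  · exact Nat.findGreatest_is_greatest hs hsN
  · exact hN s hsN

/-- A walk with finite expected number of visits to the origin is transient. -/
theorem isTransient_of_summable (h : Summable fun t => μ.real (S t ⁻¹' {0})) :
    IsTransient μ S := by
  have hne : ∑' t, μ (S t ⁻¹' {0}) ≠ ⊤ := by
    have := h.tsum_ofReal_ne_top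
    rwa [tsum_congr fun t => ofReal_measureReal (measure_ne_top μ (S t ⁻¹' {0}))] at this
  -- First Borel-Cantelli lemma.
  filter_upwards [ae_eventually_notMem hne] with ω hω
  exact hω

end Markov

theorem theorem6 {d : ℕ} (α : Fin d → ℝ) (c : ℝ) (M : ℕ) (up down : Fin d → ℤ → ℝ)
    (hmodel : IsModelFive α c M up down)
    {Ω : Type*} [MeasurableSpace Ω] (μ : Measure Ω) [IsProbabilityMeasure μ]
    (S : ℕ → Ω → (Fin d → ℤ)) (hS : IsWalk μ (stepProb up down) S) :
    (d ≤ 2 → IsRecurrent μ S) ∧ (3 ≤ d → IsTransient μ S) := by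
  have hG : ∀ n, ∑ t ∈ Finset.range n, μ.real (S t ⁻¹' {0}) = greenFun up down n 0 := fun n =>
    Finset.sum_congr rfl fun t _ => measureReal_eq_hitProb hS t
  refine ⟨fun hd => hS.isRecurrent fun hsum => ?_, fun hd => ?_⟩
  · refine hmodel.not_greenFun_le hd (∑' t, μ.real (S t ⁻¹' {0})) fun n => ?_
    rw [← hG]
    exact hsum.sum_le_tsum _ fun t _ => measureReal_nonneg
  · obtain ⟨B, hB⟩ := hmodel.exists_greenFun_le hd
    exact isTransient_of_summable (summable_of_sum_range_le (fun t => measureReal_nonneg)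
      fun n => (hG n).trans_le (hB n))
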